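/- Let $R$ be a (commutative, Noetherian) Gorenstein local ring, i.e. $R$ has finite injective dimension as a module over itself. Let $J(R)$ be the quotient of the free $\mathbb{Z}[t^{\pm1}]$-module on the isomorphism classes $[M]$ of finitely generated $R$-modules by the $\mathbb{Z}[t^{\pm1}]$-submodule generated by the following elements: * (R1) $[M]-[M']$ for every exact sequence $0\to P\to M\to M'\to 0$ of finitely generated $R$-modules with $P$ projective; * (R2) $[M]-t[M']$ for every exact sequence $0\to M'\to P\to M\to 0$ of finitely generated $R$-modules with $P$ projective; * (R3) $[M\oplus M']-[M]-[M']$ for all finitely generated $R$-modules $M$ and $M'$. The image of $[M]$ in $J(R)$ is again denoted $[M]$. A finitely generated $R$-module $M$ is called MCM (maximal Cohen–Macaulay) if $M\neq 0$ and $\operatorname{depth}_R M=\dim R$. Let $M$ and $N$ be finitely generated MCM $R$-modules. Then $[M]=[N]$ in $J(R)$ if and only if $$M\oplus R^m\cong N\oplus R^n$$ for some integers $m,n\ge 0$. In particular, if neither $M$ nor $N$ has a non-zero free direct summand, then $[M]=[N]$ in $J(R)$ if and only if $M\cong N$. -/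

import Mathlib

open scoped LaurentPolynomial

universe u

namespace GorensteinJ

/-! ### The `ℤ[t, t⁻¹]`-module `J(R)` -/

section JModule

/-- A finitely generated `R`-module, bundled. -/
structure FGMod (R : Type u) [CommRing R] where
  carrier : Type u
  [addCommGroup : AddCommGroup carrier]
  [module : Module R carrier]
  [finite : Module.Finite R carrier]

attribute [instance] FGMod.addCommGroup FGMod.module FGMod.finite

/-- Isomorphism of finitely generated `R`-modules. -/
instance FGMod.isoSetoid (R : Type u) [CommRing R] : Setoid (FGMod R) where
  r X Y := Nonempty (X.carrier ≃ₗ[R] Y.carrier)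
  iseqv :=
    { refl := fun X => ⟨LinearEquiv.refl R X.carrier⟩
      symm := fun ⟨e⟩ => ⟨e.symm⟩
      trans := fun ⟨e⟩ ⟨f⟩ => ⟨e.trans f⟩ }

/-- The set `𝒞(R)` of isomorphism classes of finitely generated `R`-modules. -/
def IsoClass (R : Type u) [CommRing R] : Type (u + 1) := Quotient (FGMod.isoSetoid R)

/-- The isomorphism class of a finitely generated `R`-module. -/
def isoClass (R : Type u) [CommRing R] (M : Type u) [AddCommGroup M] [Module R M]
    [Module.Finite R M] : IsoClass R :=
  Quotient.mk (FGMod.isoSetoid R) (FGMod.mk M)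

/-- The free `ℤ[t, t⁻¹]`-module `F` on the set of isomorphism classes of finitely generated
`R`-modules. -/
abbrev FreeOnClasses (R : Type u) [CommRing R] : Type (u + 1) := IsoClass R →₀ ℤ[T;T⁻¹]

/-- The basis element `[M]` of `F`. -/
noncomputable def basisElt (R : Type u) [CommRing R] (M : Type u) [AddCommGroup M] [Module R M]
    [Module.Finite R M] : FreeOnClasses R :=
  Finsupp.single (isoClass R M) 1

/-- The elements of `F` which are to become zero in `J(R)`. -/
inductive IsRelator (R : Type u) [CommRing R] : FreeOnClasses R → Prop
  /-- `[M] - [M']` for every exact sequence `0 → P → M → M' → 0` of finitely generated modules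
  with `P` projective. -/
  | quot (P M M' : Type u) [AddCommGroup P] [AddCommGroup M] [AddCommGroup M']
      [Module R P] [Module R M] [Module R M']
      [Module.Finite R P] [Module.Finite R M] [Module.Finite R M'] [Module.Projective R P]
      (f : P →ₗ[R] M) (g : M →ₗ[R] M')
      (hf : Function.Injective f) (hfg : Function.Exact f g) (hg : Function.Surjective g) :
      IsRelator R (basisElt R M - basisElt R M')
  /-- `[M] - t [M']` for every exact sequence `0 → M' → P → M → 0` of finitely generated modules
  with `P` projective. -/
  | syz (M' P M : Type u) [AddCommGroup M'] [AddCommGroup P] [AddCommGroup M]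
      [Module R M'] [Module R P] [Module R M]
      [Module.Finite R M'] [Module.Finite R P] [Module.Finite R M] [Module.Projective R P]
      (f : M' →ₗ[R] P) (g : P →ₗ[R] M)
      (hf : Function.Injective f) (hfg : Function.Exact f g) (hg : Function.Surjective g) :
      IsRelator R (basisElt R M - (LaurentPolynomial.T 1 : ℤ[T;T⁻¹]) • basisElt R M')
  /-- `[M ⊕ M'] - [M] - [M']` for all finitely generated modules `M` and `M'`. -/
  | sum (M M' : Type u) [AddCommGroup M] [AddCommGroup M'] [Module R M] [Module R M']
      [Module.Finite R M] [Module.Finite R M'] :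
      IsRelator R (basisElt R (M × M') - basisElt R M - basisElt R M')

/-- The `ℤ[t, t⁻¹]`-submodule `I` of `F` generated by the relators. -/
noncomputable def relations (R : Type u) [CommRing R] : Submodule ℤ[T;T⁻¹] (FreeOnClasses R) :=
  Submodule.span ℤ[T;T⁻¹] {x | IsRelator R x}

/-- The `ℤ[t, t⁻¹]`-module `J(R) = F / I`. -/
abbrev J (R : Type u) [CommRing R] : Type (u + 1) := FreeOnClasses R ⧸ relations R

/-- The class `[M]` in `J(R)` of a finitely generated `R`-module `M`. -/
noncomputable def jClass (R : Type u) [CommRing R] (M : Type u) [AddCommGroup M] [Module R M]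
    [Module.Finite R M] : J R :=
  (relations R).mkQ (basisElt R M)

end JModule

/-! ### Gorenstein local rings, maximal Cohen-Macaulay modules, free summands -/

section Local

/-- A Noetherian local ring is Gorenstein if it has finite injective dimension as a module over
itself. -/
class IsGorensteinLocalRing (R : Type u) [CommRing R] : Prop
    extends IsNoetherianRing R, IsLocalRing R where
  finite_injectiveDimension :
    ∃ n : ℕ, CategoryTheory.HasInjectiveDimensionLE (ModuleCat.of R R) n

/-- The depth of a module over a local ring: the supremum of the lengths of the `M`-regular
sequences contained in the maximal ideal. -/
noncomputable def depth (R : Type u) [CommRing R] [IsLocalRing R] (M : Type u) [AddCommGroup M]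
    [Module R M] : ℕ∞ :=
  ⨆ rs ∈ {rs : List R | (∀ r ∈ rs, r ∈ IsLocalRing.maximalIdeal R) ∧
    RingTheory.Sequence.IsRegular M rs}, (rs.length : ℕ∞)

/-- A finitely generated module over a Noetherian local ring is maximal Cohen-Macaulay (MCM) if it
is non-zero and its depth equals the Krull dimension of the ring. -/
structure IsMCM (R : Type u) [CommRing R] [IsLocalRing R] (M : Type u) [AddCommGroup M]
    [Module R M] : Prop where
  finite : Module.Finite R M
  nontrivial : Nontrivial M
  depth_eq : (depth R M : WithBot ℕ∞) = ringKrullDim R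

/-- `M` has a non-zero free direct summand. -/
def HasFreeSummand (R : Type u) [CommRing R] (M : Type u) [AddCommGroup M] [Module R M] : Prop :=
  ∃ F Q : Submodule R M, IsCompl F Q ∧ Module.Free R F ∧ Nontrivial F

end Local

end GorensteinJ

/-!
The relators `IsRelator.syz` say that `t⁻¹ [M] = [Ω M]`, so `t⁻¹` acts on `J(R)` as the syzygy
operator `Ω`, and `J(R)` is built from stable isomorphism classes of modules by formally
inverting `Ω`. Hence `[M] = [N]` only says that high syzygies of `M` and `N` agree, stably and
after adding a common module; the point is to undo the syzygies and the addition for MCM modules.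

To extract the equality of syzygies, the class `[M]` is sent to the sequence `k ↦ Ωᵏ M` in the
Grothendieck group of the monoid of stable classes, modulo sequences vanishing for large `k`; the
variable `t` acts by shifting (`relations_le_comap_eventuallyZero`, `exists_syz_iterate_eq`).
Schanuel's lemma makes `Ω` well defined on stable classes. Nothing is lost on passing to the
Grothendieck group, because finitely generated modules over a Noetherian local ring cancel from
direct sums: the endomorphism ring of such a module has stable range one (`cancel_of_finite`).

A syzygy can be undone when `Ext¹(M, R) = Ext¹(N, R) = 0`: maps from a syzygy to a free module then
extend along the presentation, and the dual of Schanuel's lemma recovers the cokernels up to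
free summands (`StablyIso.of_ker`). To undo all of `Ωᵏ` one needs `Extⁱ(M, R) = 0` for every
`i > 0`, which holds for MCM modules over a Gorenstein local ring (`IsMCM.subsingleton_ext`). Indeed
`Extⁱ(L, R) = 0` for all finite `L` and `i > dim R`: otherwise the last non-vanishing `Extⁱ` is
non-zero on the residue field, hence on the quotient of `R` by a maximal regular sequence, whose
projective dimension is at most `dim R`. An `M`-regular sequence of length `dim R` shifts this range
of vanishing down to `i > 0`.

If `M` and `N` have no free summands, cancelling the common part of `M ⊕ Rᵐ ≅ N ⊕ Rⁿ` leaves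
`M ≅ N`.
-/

namespace GorensteinJ

/-! ### Rings of stable range one -/

section StableRange

/-- A ring `A` has stable range one if, whenever `a A + b A = A`, some `a + b y` is a unit. It is
enough to ask this when `a x + b = 1`, which is the form used here. -/
def HasStableRangeOne (A : Type*) [Ring A] : Prop :=
  ∀ a x b : A, a * x + b = 1 → ∃ y, IsUnit (a + b * y)

lemma HasStableRangeOne.of_ringEquiv {A B : Type*} [Ring A] [Ring B] (e : A ≃+* B)
    (h : HasStableRangeOne A) : HasStableRangeOne B := by
  intro a x b hab
  obtain ⟨y, hy⟩ := h (e.symm a) (e.symm x) (e.symm b) (by rw [← map_mul, ← map_add, hab, map_one])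
  exact ⟨e y, by simpa using hy.map e⟩

lemma HasStableRangeOne.pi {ι : Type*} {A : ι → Type*} [∀ i, Ring (A i)]
    (h : ∀ i, HasStableRangeOne (A i)) : HasStableRangeOne (∀ i, A i) := by
  intro a x b hab
  choose y hy using fun i => h i (a i) (x i) (b i) (congrFun hab i)
  exact ⟨y, Pi.isUnit_iff.2 hy⟩

/-- Stable range one descends along a surjection that reflects units. -/
lemma HasStableRangeOne.of_surjective {A B : Type*} [Ring A] [Ring B] (f : A →+* B)
    [IsLocalHom f] (hf : Function.Surjective f) (h : HasStableRangeOne B) :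
    HasStableRangeOne A := by
  intro a x b hab
  obtain ⟨y, hy⟩ := h (f a) (f x) (f b) (by rw [← map_mul, ← map_add, hab, map_one])
  obtain ⟨y, rfl⟩ := hf y
  exact ⟨y, isUnit_of_map_unit f _ (by simpa using hy)⟩

/-- If `f` and `g` have no common kernel, some `f + y ∘ g` is injective: on `ker f`, where `g` is
injective, `y ∘ g` can be chosen to be an isomorphism onto a complement of `range f`. -/
lemma exists_injective_add_comp {D V : Type*} [DivisionRing D] [AddCommGroup V] [Module D V]
    [FiniteDimensional D V] (f g : V →ₗ[D] V) (hfg : Disjoint (LinearMap.ker f) (LinearMap.ker g)) :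
    ∃ y : V →ₗ[D] V, Function.Injective (f + y ∘ₗ g) := by
  obtain ⟨C, hC⟩ := Submodule.exists_isCompl (LinearMap.range f)
  have hdim : Module.finrank D (LinearMap.ker f) = Module.finrank D C := by
    have h₁ := f.finrank_range_add_finrank_ker
    have h₂ := Submodule.finrank_add_eq_of_isCompl hC
    omega
  let φ := LinearEquiv.ofFinrankEq (LinearMap.ker f) C hdim
  obtain ⟨l, hl⟩ := (g ∘ₗ (LinearMap.ker f).subtype).exists_leftInverse_of_injective (by
    rw [LinearMap.ker_eq_bot']
    intro v hv
    exact Subtype.ext (Submodule.disjoint_def.1 hfg v v.2 hv))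
  refine ⟨C.subtype ∘ₗ φ.toLinearMap ∘ₗ l, ?_⟩
  rw [← LinearMap.ker_eq_bot, LinearMap.ker_eq_bot']
  intro v hv
  have hv' : f v + (φ (l (g v)) : V) = 0 := hv
  have h₁ : f v = 0 := Submodule.disjoint_def.1 hC.disjoint _ ⟨v, rfl⟩ (by
    rw [eq_neg_of_add_eq_zero_left hv']
    exact C.neg_mem (φ (l (g v))).2)
  have h₂ : l (g v) = ⟨v, h₁⟩ := LinearMap.congr_fun hl ⟨v, h₁⟩
  rw [h₁, zero_add, h₂] at hv'
  have h₃ : φ ⟨v, h₁⟩ = 0 := Subtype.ext hv'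
  exact congrArg Subtype.val (φ.map_eq_zero_iff.1 h₃)

lemma hasStableRangeOne_matrix (D : Type*) [DivisionRing D] (n : ℕ) :
    HasStableRangeOne (Matrix (Fin n) (Fin n) D) := by
  intro a x b hab
  -- A matrix `M` acts on row vectors by `v ↦ v M`; this reverses products.
  obtain ⟨y, hy⟩ := exists_injective_add_comp a.toLinearMapRight' b.toLinearMapRight' (by
    rw [Submodule.disjoint_def]
    intro v hva hvb
    have h : Matrix.vecMul v (a * x + b) = 0 := by
      rw [Matrix.vecMul_add, ← Matrix.vecMul_vecMul]
      have h₁ : Matrix.vecMul v a = 0 := hva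
      have h₂ : Matrix.vecMul v b = 0 := hvb
      rw [h₁, h₂, Matrix.zero_vecMul, add_zero]
    rwa [hab, Matrix.vecMul_one] at h)
  refine ⟨LinearMap.toMatrixRight' y, ?_⟩
  let e := LinearEquiv.ofInjectiveEndo _ hy
  have he : LinearMap.toMatrixRight' e.toLinearMap = a + b * LinearMap.toMatrixRight' y := by
    have : e.toLinearMap = a.toLinearMapRight' + y ∘ₗ b.toLinearMapRight' := rfl
    rw [this, map_add, LinearMap.toMatrixRight'_comp]
    simp
  rw [← he]
  refine ⟨⟨_, LinearMap.toMatrixRight' e.symm.toLinearMap, ?_, ?_⟩, rfl⟩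
  · rw [← LinearMap.toMatrixRight'_comp]; simp
  · rw [← LinearMap.toMatrixRight'_comp]; simp

lemma hasStableRangeOne_of_isSemisimpleRing (A : Type*) [Ring A] [IsSemisimpleRing A] :
    HasStableRangeOne A := by
  obtain ⟨n, D, d, _, _, ⟨e⟩⟩ := IsSemisimpleRing.exists_ringEquiv_pi_matrix_divisionRing A
  exact (HasStableRangeOne.pi fun i => hasStableRangeOne_matrix (D i) (d i)).of_ringEquiv e.symm

lemma hasStableRangeOne_of_isArtinianRing (A : Type*) [Ring A] [IsArtinianRing A] :
    HasStableRangeOne A := by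
  have : IsLocalHom (Ideal.Quotient.mk (Ring.jacobson A)) := by
    refine ⟨fun a ha => ?_⟩
    -- An element congruent to `1` modulo the nilpotent ideal `Ring.jacobson A` is a unit.
    have key (c : A) (hc : Ideal.Quotient.mk (Ring.jacobson A) c = 1) : IsUnit c := by
      have hmem : c - 1 ∈ Ring.jacobson A := by
        rw [← Ideal.Quotient.eq_zero_iff_mem, map_sub, hc, map_one, sub_self]
      obtain ⟨k, hk⟩ := IsSemiprimaryRing.isNilpotent (R := A)
      have hnil : IsNilpotent (c - 1) :=
        ⟨k, by simpa [hk] using Ideal.pow_mem_pow hmem k⟩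
      simpa using hnil.isUnit_one_add
    obtain ⟨b, hab, hba⟩ := isUnit_iff_exists.1 ha
    obtain ⟨b, rfl⟩ := Ideal.Quotient.mk_surjective b
    rw [← map_mul] at hab hba
    obtain ⟨u, hu, -⟩ := isUnit_iff_exists.1 (key _ hab)
    obtain ⟨v, -, hv⟩ := isUnit_iff_exists.1 (key _ hba)
    exact isUnit_iff_exists_and_exists.2 ⟨⟨b * u, by rw [← mul_assoc, hu]⟩,
      ⟨v * b, by rw [mul_assoc, hv]⟩⟩
  exact (hasStableRangeOne_of_isSemisimpleRing (A ⧸ Ring.jacobson A)).of_surjective _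
    Ideal.Quotient.mk_surjective

open IsLocalRing TensorProduct in
/-- The finite-dimensional algebra `k ⊗ End L` over the residue field `k` detects units of `End L`,
because by Nakayama's lemma an endomorphism which is surjective modulo the maximal ideal is
surjective, hence bijective. -/
lemma hasStableRangeOne_end (R L : Type*) [CommRing R] [IsNoetherianRing R] [IsLocalRing R]
    [AddCommGroup L] [Module R L] [Module.Finite R L] : HasStableRangeOne (Module.End R L) := by
  let A := ResidueField R ⊗[R] Module.End R L
  let π : Module.End R L →ₐ[R] A := Algebra.TensorProduct.includeRight
  have : IsArtinianRing A := IsArtinianRing.of_finite (ResidueField R) A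
  have hπ : Function.Surjective π := TensorProduct.mk_surjective _ _ _ residue_surjective
  have : IsLocalHom (π : Module.End R L →+* A) := by
    refine ⟨fun f hf => ?_⟩
    let β : A →ₐ[ResidueField R] Module.End (ResidueField R) (ResidueField R ⊗[R] L) :=
      Algebra.TensorProduct.lift (Algebra.ofId _ _) (Module.End.baseChangeHom R (ResidueField R) L)
        (fun x y => Algebra.commutes _ _)
    have hβ : β (π f) = f.baseChange (ResidueField R) := by
      refine (Algebra.TensorProduct.lift_tmul _ _ _ _ _).trans ?_
      rw [map_one, one_mul]
      rfl
    have hsurj : Function.Surjective (f.baseChange (ResidueField R)) := by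
      rw [← hβ]
      exact ((Module.End.isUnit_iff _).1 (hf.map β)).2
    have hrange : LinearMap.range f = ⊤ := by
      rw [← IsLocalRing.map_tensorProduct_mk_eq_top, eq_top_iff]
      intro z _
      obtain ⟨w, rfl⟩ := hsurj z
      obtain ⟨w, rfl⟩ := TensorProduct.mk_surjective R L (ResidueField R) residue_surjective w
      exact ⟨f w, ⟨w, rfl⟩, by simp⟩
    rw [Module.End.isUnit_iff]
    exact OrzechProperty.bijective_of_surjective_endomorphism f (LinearMap.range_eq_top.1 hrange)
  exact (hasStableRangeOne_of_isArtinianRing A).of_surjective (π : Module.End R L →+* A) hπ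

end StableRange

/-! ### Cancellation of finitely generated modules over a local ring -/

section Cancellation

variable {R M N L : Type*} [CommRing R] [AddCommGroup M] [AddCommGroup N] [AddCommGroup L]
  [Module R M] [Module R N] [Module R L]

/-- If the `L → L` component of an isomorphism `M × L ≃ N × L` is invertible, then `M` and `N` are
both isomorphic to the kernel of the `L`-component `M × L → L`. -/
lemma nonempty_equiv_of_isUnit_corner (φ : (M × L) ≃ₗ[R] (N × L)) {δ : Module.End R L}
    (hδ : IsUnit δ) (h : ∀ l, (φ (0, l)).2 = δ l) : Nonempty (M ≃ₗ[R] N) := by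
  let f : M →ₗ[R] N := LinearMap.fst R N L ∘ₗ φ.toLinearMap ∘ₗ
    LinearMap.prod LinearMap.id
      (-(hδ.unit⁻¹ : (Module.End R L)ˣ).1 ∘ₗ LinearMap.snd R N L ∘ₗ φ.toLinearMap ∘ₗ
        LinearMap.inl R M L)
  have hinv (l : L) : δ ((hδ.unit⁻¹ : (Module.End R L)ˣ).1 l) = l :=
    LinearMap.congr_fun hδ.mul_val_inv l
  have hinv' (l : L) : (hδ.unit⁻¹ : (Module.End R L)ˣ).1 (δ l) = l :=
    LinearMap.congr_fun hδ.val_inv_mul l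
  have hsplit (m : M) (l : L) : (φ (m, l)).2 = (φ (m, 0)).2 + δ l := by
    rw [← h, ← Prod.snd_add, ← map_add]; simp
  have hf (m : M) :
      φ (m, -(hδ.unit⁻¹ : (Module.End R L)ˣ).1 (φ (m, 0)).2) = (f m, 0) := by
    refine Prod.ext rfl ?_
    rw [hsplit, map_neg, hinv]; simp
  refine ⟨LinearEquiv.ofBijective f ⟨?_, fun n => ?_⟩⟩
  · rw [← LinearMap.ker_eq_bot, LinearMap.ker_eq_bot']
    intro m hm
    have := hf m
    rw [hm, Prod.mk_zero_zero, LinearEquiv.map_eq_zero_iff] at this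
    exact congrArg Prod.fst this
  · obtain ⟨⟨m, l⟩, hml⟩ := φ.surjective (n, 0)
    have hl : l = -(hδ.unit⁻¹ : (Module.End R L)ˣ).1 (φ (m, 0)).2 := by
      have h₀ := hsplit m l
      rw [hml] at h₀
      rw [eq_neg_of_add_eq_zero_left h₀.symm, map_neg, neg_neg, hinv']
    refine ⟨m, ?_⟩
    have := hf m
    rw [← hl, hml] at this
    exact (congrArg Prod.fst this).symm

/-- Evans' cancellation theorem: a module whose endomorphism ring has stable range one cancels from
direct sums. An elementary automorphism of `M × L` makes the `L → L` component invertible. -/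
theorem cancel_of_hasStableRangeOne (hL : HasStableRangeOne (Module.End R L))
    (φ : (M × L) ≃ₗ[R] (N × L)) : Nonempty (M ≃ₗ[R] N) := by
  let δ : Module.End R L := LinearMap.snd R N L ∘ₗ φ.toLinearMap ∘ₗ LinearMap.inr R M L
  let γ : M →ₗ[R] L := LinearMap.snd R N L ∘ₗ φ.toLinearMap ∘ₗ LinearMap.inl R M L
  let δ' : Module.End R L := LinearMap.snd R M L ∘ₗ φ.symm.toLinearMap ∘ₗ LinearMap.inr R N L
  let β' : L →ₗ[R] M := LinearMap.fst R M L ∘ₗ φ.symm.toLinearMap ∘ₗ LinearMap.inr R N L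
  have hsplit (m : M) (l : L) : (φ (m, l)).2 = γ m + δ l := by
    change _ = (φ (m, 0)).2 + (φ (0, l)).2
    rw [← Prod.snd_add, ← map_add]; simp
  obtain ⟨y, hy⟩ := hL δ δ' (γ ∘ₗ β') (by
    ext l
    change δ (δ' l) + γ (β' l) = l
    rw [add_comm, ← hsplit]
    change (φ (φ.symm (0, l))).2 = l
    rw [φ.apply_symm_apply])
  let ε : (M × L) ≃ₗ[R] (M × L) := LinearEquiv.ofLinearMap
    (LinearMap.prod (LinearMap.fst R M L + β' ∘ₗ y ∘ₗ LinearMap.snd R M L) (LinearMap.snd R M L))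
    (LinearMap.prod (LinearMap.fst R M L - β' ∘ₗ y ∘ₗ LinearMap.snd R M L) (LinearMap.snd R M L))
    (by ext <;> simp) (by ext <;> simp)
  refine nonempty_equiv_of_isUnit_corner (ε.trans φ) hy fun l => ?_
  have : ε (0, l) = (β' (y l), l) := by simp [ε]
  rw [LinearEquiv.trans_apply, this, hsplit, add_comm]
  rfl

theorem cancel_of_finite [IsNoetherianRing R] [IsLocalRing R] [Module.Finite R L]
    (φ : (M × L) ≃ₗ[R] (N × L)) : Nonempty (M ≃ₗ[R] N) :=
  cancel_of_hasStableRangeOne (hasStableRangeOne_end R L) φ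

end Cancellation

/-! ### Vanishing of `Ext` against a Gorenstein local ring -/

section ExtVanishing

open CategoryTheory Abelian IsLocalRing RingTheory.Sequence

variable {R : Type u} [CommRing R]

/-- Multiplication by `x` is surjective on `Ext^i(M, N)` as soon as `Ext^{i+1}(M/xM, N) = 0`, so
Nakayama's lemma applies. -/
lemma subsingleton_ext_of_quotSMulTop [IsNoetherianRing R] [IsLocalRing R] (M N : ModuleCat.{u} R)
    [Module.Finite R M] [Module.Finite R N] {x : R}
    (hx : IsSMulRegular M x) (hxm : x ∈ maximalIdeal R) (i : ℕ)
    (h : Subsingleton (Ext (ModuleCat.of R (QuotSMulTop x M)) N (i + 1))) :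
    Subsingleton (Ext M N i) := by
  have hS := hx.smulShortComplex_shortExact
  by_contra hne
  rw [not_subsingleton_iff_nontrivial] at hne
  refine Submodule.top_ne_pointwise_smul_of_mem_jacobson_annihilator
    (R := R) (M := Ext M N i) (r := x) (maximalIdeal_le_jacobson _ hxm) ?_
  rw [eq_comm, eq_top_iff]
  intro y _
  obtain ⟨z, hz⟩ := Ext.contravariant_sequence_exact₁ hS N y (add_comm 1 i) (h.elim _ _)
  have hz' : x • (show Ext M N i from z) = y := by
    have h₁ : (Ext.mk₀ (x • 𝟙 M)).comp (show Ext M N i from z) (zero_add i) = y := hz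
    rw [← h₁, Ext.mk₀_smul, Ext.smul_comp, Ext.mk₀_id_comp]
  rw [← hz']
  exact Submodule.smul_mem_pointwise_smul _ _ ⊤ trivial

lemma subsingleton_ext_of_exact {N : ModuleCat.{u} R} {i : ℕ} {A B C : Type u} [AddCommGroup A]
    [AddCommGroup B] [AddCommGroup C] [Module R A] [Module R B] [Module R C]
    (f : A →ₗ[R] B) (g : B →ₗ[R] C) (hf : Function.Injective f) (hg : Function.Surjective g)
    (hfg : Function.Exact f g) (hA : Subsingleton (Ext (ModuleCat.of R A) N i))
    (hC : Subsingleton (Ext (ModuleCat.of R C) N i)) :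
    Subsingleton (Ext (ModuleCat.of R B) N i) := by
  let S := ModuleCat.shortComplexOfCompEqZero f g hfg.linearMap_comp_eq_zero
  have hS : S.ShortExact := ModuleCat.shortComplex_shortExact S hfg hf hg
  refine subsingleton_of_forall_eq 0 fun y => ?_
  obtain ⟨z, rfl⟩ := Ext.contravariant_sequence_exact₂ hS N y (hA.elim _ _)
  rw [Subsingleton.elim z 0, Ext.comp_zero]

lemma subsingleton_ext_of_injective {N : ModuleCat.{u} R} {i : ℕ} {A B : Type u} [AddCommGroup A]
    [AddCommGroup B] [Module R A] [Module R B] (f : A →ₗ[R] B) (hf : Function.Injective f)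
    (hB : Subsingleton (Ext (ModuleCat.of R B) N i))
    (hC : Subsingleton (Ext (ModuleCat.of R (B ⧸ LinearMap.range f)) N (i + 1))) :
    Subsingleton (Ext (ModuleCat.of R A) N i) := by
  let S := ModuleCat.shortComplexOfCompEqZero f (LinearMap.range f).mkQ
    f.exact_map_mkQ_range.linearMap_comp_eq_zero
  have hS : S.ShortExact := ModuleCat.shortComplex_shortExact S f.exact_map_mkQ_range hf
    (Submodule.mkQ_surjective _)
  refine subsingleton_of_forall_eq 0 fun y => ?_
  obtain ⟨z, rfl⟩ := Ext.contravariant_sequence_exact₁ hS N y (add_comm 1 i) (hC.elim _ _)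
  have : z = 0 := hB.elim _ _
  rw [this, Ext.comp_zero]

lemma subsingleton_ext_of_linearEquiv {N : ModuleCat.{u} R} {i : ℕ} {A B : Type u} [AddCommGroup A]
    [AddCommGroup B] [Module R A] [Module R B] (e : A ≃ₗ[R] B)
    (hB : Subsingleton (Ext (ModuleCat.of R B) N i)) :
    Subsingleton (Ext (ModuleCat.of R A) N i) := by
  refine subsingleton_of_forall_eq 0 fun y => ?_
  have h : y = (Ext.mk₀ e.toModuleIso.hom).comp
      ((Ext.mk₀ e.toModuleIso.inv).comp y (zero_add i)) (zero_add i) := by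
    rw [Ext.mk₀_comp_mk₀_assoc, Iso.hom_inv_id, Ext.mk₀_id_comp]
  rw [h, hB.elim ((Ext.mk₀ e.toModuleIso.inv).comp y (zero_add i)) 0, Ext.comp_zero]

variable (R) in
lemma exists_ringKrullDim_eq [IsNoetherianRing R] [IsLocalRing R] :
    ∃ d : ℕ, ringKrullDim R = d := by
  have h₁ := ringKrullDim_ne_bot (R := R)
  have h₂ := ringKrullDim_ne_top (R := R)
  obtain ⟨e, he⟩ := WithBot.ne_bot_iff_exists.1 h₁
  rw [← he] at h₂ ⊢
  obtain ⟨d, rfl⟩ : ∃ d : ℕ, (d : ℕ∞) = e := ENat.ne_top_iff_exists.1 (fun h => h₂ (by rw [h]; rfl))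
  exact ⟨d, rfl⟩

variable (R) in
/-- The quotient of `R` by a regular sequence which cannot be prolonged has depth zero, that is, it
contains a copy of the residue field. -/
lemma exists_isRegular_residueField_embedding [IsNoetherianRing R] [IsLocalRing R] :
    ∃ rs : List R, IsRegular R rs ∧ (rs.length : WithBot ℕ∞) ≤ ringKrullDim R ∧
      ∃ f : ResidueField R →ₗ[R] R ⧸ (Ideal.ofList rs • (⊤ : Submodule R R)),
        Function.Injective f := by
  have hle (rs : List R) (hrs : IsRegular R rs) : (rs.length : WithBot ℕ∞) ≤ ringKrullDim R := by
    rw [← ringKrullDim_add_length_eq_ringKrullDim_of_isRegular rs hrs]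
    have : Nontrivial (R ⧸ Ideal.ofList rs) := by
      rw [Ideal.Quotient.nontrivial_iff]
      simpa using hrs.top_ne_smul.symm
    exact le_add_of_nonneg_left ringKrullDim_nonneg_of_nontrivial
  obtain ⟨d, hd⟩ := exists_ringKrullDim_eq R
  let s : Set ℕ := {n | ∃ rs : List R, IsRegular R rs ∧ rs.length = n}
  have hbdd : BddAbove s := by
    refine ⟨d, ?_⟩
    rintro _ ⟨rs, hrs, rfl⟩
    have := hle rs hrs
    rw [hd] at this
    exact_mod_cast this
  -- A regular sequence of maximal length; it exists because lengths are bounded by `dim R`.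
  obtain ⟨rs, hrs, hlen⟩ := Nat.sSup_mem (s := s) ⟨0, [], IsRegular.nil R R, rfl⟩ hbdd
  refine ⟨rs, hrs, hle rs hrs, ?_⟩
  have hmem : ∀ r ∈ rs, r ∈ maximalIdeal R := by
    intro r hr
    have : Ideal.ofList rs ≠ ⊤ := by simpa using hrs.top_ne_smul.symm
    exact le_maximalIdeal this (Ideal.subset_span hr)
  have hhom :
      ¬ Subsingleton (ResidueField R →ₗ[R] R ⧸ (Ideal.ofList rs • (⊤ : Submodule R R))) := by
    rw [IsSMulRegular.subsingleton_linearMap_iff]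
    rintro ⟨r, hr, hreg⟩
    have hrm : r ∈ maximalIdeal R := by
      have h₁ := Module.mem_annihilator.1 hr 1
      rw [Algebra.smul_def, mul_one] at h₁
      exact (residue_eq_zero_iff r).1 h₁
    have hrs' : IsRegular R (rs ++ [r]) :=
      IsRegular.of_isWeaklyRegular_of_mem_maximalIdeal R
        (by simpa [or_imp, forall_and] using ⟨hmem, hrm⟩)
        ((isWeaklyRegular_append_iff R rs [r]).2
          ⟨hrs.toIsWeaklyRegular, (isWeaklyRegular_singleton_iff _ _).2 hreg⟩)
    have := le_csSup hbdd ⟨rs ++ [r], hrs', rfl⟩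
    rw [← hlen] at this
    simp at this
  rw [not_subsingleton_iff_nontrivial] at hhom
  obtain ⟨f, hf⟩ := exists_ne (0 : ResidueField R →ₗ[R] R ⧸ (Ideal.ofList rs • (⊤ : Submodule R R)))
  refine ⟨f, ?_⟩
  rw [← LinearMap.ker_eq_bot, LinearMap.ker_eq_bot']
  intro a ha
  by_contra hne
  refine hf (LinearMap.ext fun b => ?_)
  obtain ⟨r, hr⟩ := residue_surjective (b / a)
  have : b = r • a := by
    rw [Algebra.smul_def]
    change b = residue R r * a
    rw [hr, div_mul_cancel₀ _ hne]
  rw [this, map_smul, ha, smul_zero, LinearMap.zero_apply]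

/-- If `Ext^{i+1}(-, R)` vanishes on finite modules and `dim R < i`, then so does `Ext^i(-, R)`.
By filtering modules by quotients `R/p` and multiplying by an element outside `p`, it is enough to
treat the residue field, which embeds into a module of projective dimension at most `dim R`. -/
lemma subsingleton_ext_step [IsNoetherianRing R] [IsLocalRing R] {i : ℕ}
    (hi : ringKrullDim R < i)
    (h : ∀ (L : Type u) [AddCommGroup L] [Module R L] [Module.Finite R L],
      Subsingleton (Ext (ModuleCat.of R L) (ModuleCat.of R R) (i + 1)))
    (L : Type u) [AddCommGroup L] [Module R L] [Module.Finite R L] :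
    Subsingleton (Ext (ModuleCat.of R L) (ModuleCat.of R R) i) := by
  have hk : Subsingleton (Ext (ModuleCat.of R (ResidueField R)) (ModuleCat.of R R) i) := by
    obtain ⟨rs, hrs, hlen, f, hf⟩ := exists_isRegular_residueField_embedding R
    refine subsingleton_ext_of_injective f hf ?_ (h _)
    have hpd := ModuleCat.projectiveDimension_quotient_eq_add_length_of_isWeaklyRegular
      (ModuleCat.of R R) rs hrs.toIsWeaklyRegular (by
        intro r hr
        have : Ideal.ofList rs ≠ ⊤ := by simpa using hrs.top_ne_smul.symm
        exact le_maximalIdeal this (Ideal.subset_span hr))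
    have hR : projectiveDimension (ModuleCat.of R R) = 0 :=
      ModuleCat.projectiveDimension_eq_zero_of_projective _
    rw [hR, zero_add] at hpd
    have hlt : projectiveDimension (ModuleCat.of R
        ((ModuleCat.of R R) ⧸ Ideal.ofList rs • (⊤ : Submodule R (ModuleCat.of R R)))) < i := by
      rw [hpd]
      exact hlen.trans_lt hi
    have := projectiveDimension_lt_iff.1 hlt
    exact HasProjectiveDimensionLT.subsingleton (ModuleCat.of R
        ((ModuleCat.of R R) ⧸ Ideal.ofList rs • (⊤ : Submodule R (ModuleCat.of R R)))) i i le_rfl _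
  induction (inferInstance : Module.Finite R L) using
    IsNoetherianRing.induction_on_isQuotientEquivQuotientPrime R with
  | subsingleton N =>
    have : Limits.IsZero (ModuleCat.of R N) := ModuleCat.isZero_of_subsingleton _
    have := this.hasProjectiveDimensionLT_zero
    exact HasProjectiveDimensionLT.subsingleton _ 0 i (Nat.zero_le i) _
  | quotient N p e =>
    refine subsingleton_ext_of_linearEquiv e ?_
    by_cases hp : p.1 = maximalIdeal R
    · rw [hp]
      exact hk
    obtain ⟨x, hxm, hxp⟩ := SetLike.exists_of_lt
      (lt_of_le_of_ne (le_maximalIdeal p.2.ne_top) hp)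
    refine subsingleton_ext_of_quotSMulTop _ _ (x := x) ?_ hxm i (h _)
    refine (isSMulRegular_iff_right_eq_zero_of_smul).2 fun y hy => ?_
    obtain ⟨y, rfl⟩ := Ideal.Quotient.mk_surjective y
    have hy' : Ideal.Quotient.mk p.1 (x * y) = 0 := hy
    rw [Ideal.Quotient.eq_zero_iff_mem] at hy' ⊢
    exact (p.2.mem_or_mem hy').resolve_left hxp
  | exact N₁ N₂ N₃ f g hf hg hfg h₁ h₃ =>
    exact subsingleton_ext_of_exact f g hf hg hfg h₁ h₃

/-- The injective dimension of a Gorenstein local ring is at most its Krull dimension, tested on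
finite modules. -/
theorem subsingleton_ext_of_ringKrullDim_lt [IsGorensteinLocalRing R] {i : ℕ}
    (hi : ringKrullDim R < i) (L : Type u) [AddCommGroup L] [Module R L] [Module.Finite R L] :
    Subsingleton (Ext (ModuleCat.of R L) (ModuleCat.of R R) i) := by
  obtain ⟨n, hn⟩ := IsGorensteinLocalRing.finite_injectiveDimension (R := R)
  obtain hni | ⟨k, hk⟩ : n + 1 ≤ i ∨ ∃ k, i + k = n + 1 :=
    (le_total (n + 1) i).imp id fun h => ⟨n + 1 - i, by omega⟩
  · exact HasInjectiveDimensionLT.subsingleton _ (n + 1) i hni _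
  induction k generalizing i L with
  | zero => exact HasInjectiveDimensionLT.subsingleton _ (n + 1) i (by omega) _
  | succ k ih =>
    refine subsingleton_ext_step hi (fun L _ _ _ => ih ?_ L (by omega)) L
    exact hi.trans (by exact_mod_cast Nat.lt_succ_self i)

/-- An `M`-regular sequence of length `l` shifts the vanishing range of `Ext^i(M, -)` by `l`. -/
lemma subsingleton_ext_of_isRegular [IsNoetherianRing R] [IsLocalRing R] {d : ℕ}
    (h : ∀ i, d < i → ∀ (L : Type u) [AddCommGroup L] [Module R L] [Module.Finite R L],
      Subsingleton (Ext (ModuleCat.of R L) (ModuleCat.of R R) i))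
    (rs : List R) (hrs : ∀ r ∈ rs, r ∈ maximalIdeal R) (M : Type u) [AddCommGroup M] [Module R M]
    [Module.Finite R M] (hreg : IsRegular M rs) (i : ℕ) (hi : d < i + rs.length) :
    Subsingleton (Ext (ModuleCat.of R M) (ModuleCat.of R R) i) := by
  induction rs generalizing M i with
  | nil => exact h i (by simpa using hi) M
  | cons x rs ih =>
    rw [isRegular_cons_iff] at hreg
    rw [List.length_cons] at hi
    refine subsingleton_ext_of_quotSMulTop (ModuleCat.of R M) _ hreg.1 (hrs x (by simp)) i ?_
    exact ih (fun r hr => hrs r (by simp [hr])) _ hreg.2 (i + 1) (by omega)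

/-- `Ext^i(M, R) = 0` for all `i > 0` when `M` is MCM over a Gorenstein local ring. -/
theorem IsMCM.subsingleton_ext [IsGorensteinLocalRing R] (M : Type u) [AddCommGroup M] [Module R M]
    [Module.Finite R M] (hM : IsMCM R M) (i : ℕ) (hi : 0 < i) :
    Subsingleton (Ext (ModuleCat.of R M) (ModuleCat.of R R) i) := by
  obtain ⟨d, hd⟩ : ∃ d : ℕ, ringKrullDim R = d := exists_ringKrullDim_eq R
  have hdepth := hM.depth_eq
  rw [hd] at hdepth
  have hdepth' : depth R M = d := by exact_mod_cast hdepth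
  obtain ⟨rs, hrs, hreg, hlen⟩ : ∃ rs : List R, (∀ r ∈ rs, r ∈ maximalIdeal R) ∧
      IsRegular M rs ∧ d ≤ rs.length := by
    have := hM.nontrivial
    by_contra! hlt
    obtain _ | d := d
    · exact absurd (hlt [] (by simp) (IsRegular.nil R M)) (by simp)
    · have : depth R M ≤ d := iSup₂_le fun rs hrs => by
        exact_mod_cast Nat.lt_succ_iff.1 (hlt rs hrs.1 hrs.2)
      rw [hdepth'] at this
      have : d + 1 ≤ d := by exact_mod_cast this
      omega
  refine subsingleton_ext_of_isRegular (d := d) (fun j hj L _ _ _ => ?_) rs hrs M hreg i (by omega)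
  exact subsingleton_ext_of_ringKrullDim_lt (by rw [hd]; exact_mod_cast hj) L

end ExtVanishing

/-! ### Stable isomorphism and Schanuel's lemma -/

section StablyIso

variable {R : Type*} [CommRing R]

/-- `M` and `N` are stably isomorphic if they become isomorphic after adding free modules of finite
rank to both. -/
def StablyIso (R M N : Type*) [CommRing R] [AddCommGroup M] [AddCommGroup N] [Module R M]
    [Module R N] : Prop :=
  ∃ m n : ℕ, Nonempty ((M × (Fin m → R)) ≃ₗ[R] (N × (Fin n → R)))

variable {M N K A B P Q : Type*} [AddCommGroup M] [AddCommGroup N] [AddCommGroup K] [AddCommGroup A]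
  [AddCommGroup B] [AddCommGroup P] [AddCommGroup Q] [Module R M] [Module R N] [Module R K]
  [Module R A] [Module R B] [Module R P] [Module R Q]

lemma nonempty_equiv_fin_fun (R A : Type*) [CommRing R] [AddCommGroup A] [Module R A]
    [Module.Finite R A] [Module.Free R A] : ∃ n : ℕ, Nonempty (A ≃ₗ[R] (Fin n → R)) := by
  let b := Module.Free.chooseBasis R A
  exact ⟨_, ⟨(b.reindex (Fintype.equivFin _)).equivFun⟩⟩

lemma StablyIso.of_free [Module.Finite R A] [Module.Free R A] [Module.Finite R B] [Module.Free R B]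
    (e : (M × A) ≃ₗ[R] (N × B)) : StablyIso R M N := by
  obtain ⟨m, ⟨f⟩⟩ := nonempty_equiv_fin_fun R A
  obtain ⟨n, ⟨g⟩⟩ := nonempty_equiv_fin_fun R B
  exact ⟨m, n, ⟨(LinearEquiv.prodCongr (.refl R M) f.symm).trans
    (e.trans (LinearEquiv.prodCongr (.refl R N) g))⟩⟩

lemma StablyIso.of_equiv (e : M ≃ₗ[R] N) : StablyIso R M N :=
  ⟨0, 0, ⟨LinearEquiv.prodCongr e (.refl R _)⟩⟩

lemma StablyIso.symm : StablyIso R M N → StablyIso R N M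
  | ⟨m, n, ⟨e⟩⟩ => ⟨n, m, ⟨e.symm⟩⟩

lemma StablyIso.trans : StablyIso R M N → StablyIso R N K → StablyIso R M K
  | ⟨m, n, ⟨e⟩⟩, ⟨p, q, ⟨f⟩⟩ => .of_free (A := (Fin m → R) × (Fin p → R))
      (B := (Fin q → R) × (Fin n → R)) <|
    (LinearEquiv.prodAssoc R M _ _).symm ≪≫ₗ LinearEquiv.prodCongr e (.refl R _) ≪≫ₗ
    LinearEquiv.prodAssoc R N _ _ ≪≫ₗ
    LinearEquiv.prodCongr (.refl R N) (LinearEquiv.prodComm R _ _) ≪≫ₗ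
    (LinearEquiv.prodAssoc R N _ _).symm ≪≫ₗ LinearEquiv.prodCongr f (.refl R _) ≪≫ₗ
    LinearEquiv.prodAssoc R K _ _

lemma StablyIso.prod {M' N' : Type*} [AddCommGroup M'] [AddCommGroup N'] [Module R M']
    [Module R N'] : StablyIso R M N → StablyIso R M' N' → StablyIso R (M × M') (N × N')
  | ⟨_, _, ⟨e⟩⟩, ⟨_, _, ⟨f⟩⟩ => .of_free <|
    LinearEquiv.prodProdProdComm R M M' _ _ ≪≫ₗ LinearEquiv.prodCongr e f ≪≫ₗ
    LinearEquiv.prodProdProdComm R N _ N' _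

/-- Cancellation up to stable isomorphism. -/
lemma StablyIso.cancel [IsNoetherianRing R] [IsLocalRing R] [Module.Finite R K] :
    StablyIso R (M × K) (N × K) → StablyIso R M N
  | ⟨m, n, ⟨e⟩⟩ => by
    obtain ⟨f⟩ := cancel_of_finite (L := K) (M := M × (Fin m → R)) (N := N × (Fin n → R)) <|
      LinearEquiv.prodAssoc R M _ K ≪≫ₗ
      LinearEquiv.prodCongr (.refl R M) (LinearEquiv.prodComm R _ _) ≪≫ₗ
      (LinearEquiv.prodAssoc R M _ _).symm ≪≫ₗ e ≪≫ₗ LinearEquiv.prodAssoc R N _ _ ≪≫ₗ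
      LinearEquiv.prodCongr (.refl R N) (LinearEquiv.prodComm R _ _) ≪≫ₗ
      (LinearEquiv.prodAssoc R N _ _).symm
    exact ⟨m, n, ⟨f⟩⟩

/-- Schanuel's lemma. -/
lemma schanuel [Module.Projective R P] [Module.Projective R Q] (p : P →ₗ[R] M) (q : Q →ₗ[R] M)
    (hp : Function.Surjective p) (hq : Function.Surjective q) :
    Nonempty ((LinearMap.ker p × Q) ≃ₗ[R] (LinearMap.ker q × P)) := by
  obtain ⟨a, ha⟩ := Module.projective_lifting_property q p hq
  obtain ⟨b, hb⟩ := Module.projective_lifting_property p q hp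
  replace ha (x : P) : q (a x) = p x := LinearMap.congr_fun ha x
  replace hb (y : Q) : p (b y) = q y := LinearMap.congr_fun hb y
  -- Inside `P × Q`, both sides are carried to the kernel of `(x, y) ↦ p x + q y` by shears.
  let f : (LinearMap.ker p × Q) →ₗ[R] P :=
    (LinearMap.ker p).subtype ∘ₗ LinearMap.fst R _ _ - b ∘ₗ LinearMap.snd R _ _
  let g : (LinearMap.ker q × P) →ₗ[R] Q :=
    (LinearMap.ker q).subtype ∘ₗ LinearMap.fst R _ _ - a ∘ₗ LinearMap.snd R _ _
  refine ⟨LinearEquiv.ofLinearMap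
    (LinearMap.prod (LinearMap.codRestrict _ (LinearMap.snd R _ _ + a ∘ₗ f) fun z => ?_) f)
    (LinearMap.prod (LinearMap.codRestrict _ (LinearMap.snd R _ _ + b ∘ₗ g) fun z => ?_) g) ?_ ?_⟩
  · have := LinearMap.mem_ker.1 z.1.2
    simp [f, ha, hb, this]
  · have := LinearMap.mem_ker.1 z.1.2
    simp [g, ha, hb, this]
  · ext <;> simp [f, g]
  · ext <;> simp [f, g]

/-- The kernel of a product of two maps is the product of their kernels. -/
def kerProdMapEquiv (p : P →ₗ[R] M) (q : Q →ₗ[R] N) :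
    LinearMap.ker (p.prodMap q) ≃ₗ[R] LinearMap.ker p × LinearMap.ker q where
  toFun z := (⟨z.1.1, congrArg Prod.fst z.2⟩, ⟨z.1.2, congrArg Prod.snd z.2⟩)
  invFun z := ⟨(z.1, z.2), Prod.ext z.1.2 z.2.2⟩
  map_add' _ _ := rfl
  map_smul' _ _ := rfl

/-- The kernel of `(x, y) ↦ p x` on `P × A` is `ker p × A`. -/
def kerCompFstEquiv (p : P →ₗ[R] M) (A : Type*) [AddCommGroup A] [Module R A] :
    LinearMap.ker (p ∘ₗ LinearMap.fst R P A) ≃ₗ[R] LinearMap.ker p × A where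
  toFun z := (⟨z.1.1, z.2⟩, z.1.2)
  invFun z := ⟨(z.1, z.2), z.1.2⟩
  map_add' _ _ := rfl
  map_smul' _ _ := rfl

lemma StablyIso.ker_prodMap_id (p : P →ₗ[R] M) (n : ℕ) : StablyIso R (LinearMap.ker p)
    (LinearMap.ker (p.prodMap (LinearMap.id : (Fin n → R) →ₗ[R] Fin n → R))) := by
  have : Subsingleton (LinearMap.ker (LinearMap.id : (Fin n → R) →ₗ[R] Fin n → R)) := by
    rw [LinearMap.ker_id]; infer_instance
  have : Unique (LinearMap.ker (LinearMap.id : (Fin n → R) →ₗ[R] Fin n → R)) :=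
    Unique.mk' _
  exact .of_equiv ((kerProdMapEquiv p _).trans LinearEquiv.prodUnique).symm

/-- Syzygies of stably isomorphic modules are stably isomorphic. -/
lemma StablyIso.ker [Module.Finite R P] [Module.Free R P] [Module.Finite R Q] [Module.Free R Q]
    (h : StablyIso R M N) (p : P →ₗ[R] M) (q : Q →ₗ[R] N) (hp : Function.Surjective p)
    (hq : Function.Surjective q) : StablyIso R (LinearMap.ker p) (LinearMap.ker q) := by
  obtain ⟨m, n, ⟨e⟩⟩ := h
  let p' := p.prodMap (LinearMap.id : (Fin m → R) →ₗ[R] _)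
  let q' := q.prodMap (LinearMap.id : (Fin n → R) →ₗ[R] _)
  obtain ⟨f⟩ := schanuel (e.toLinearMap ∘ₗ p') q'
    (e.surjective.comp (hp.prodMap Function.surjective_id)) (hq.prodMap Function.surjective_id)
  have h₁ : StablyIso R (LinearMap.ker (e.toLinearMap ∘ₗ p')) (LinearMap.ker q') := .of_free f
  exact (StablyIso.ker_prodMap_id p m).trans (((StablyIso.of_equiv (LinearEquiv.ofEq _ _
    (LinearEquiv.ker_comp e p').symm)).trans h₁).trans (StablyIso.ker_prodMap_id q n).symm)

/-- Dividing out a projective submodule does not change the syzygy: a presentation `q` of the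
quotient lifts to a presentation of `M` with the same kernel. -/
lemma exists_coprod_ker_equiv {M' F : Type*} [AddCommGroup M'] [AddCommGroup F] [Module R M']
    [Module R F] [Module.Projective R F] (f : P →ₗ[R] M) (g : M →ₗ[R] M')
    (hf : Function.Injective f) (hfg : Function.Exact f g) (hg : Function.Surjective g)
    (q : F →ₗ[R] M') (hq : Function.Surjective q) :
    ∃ s : (F × P) →ₗ[R] M, Function.Surjective s ∧
      Nonempty (LinearMap.ker s ≃ₗ[R] LinearMap.ker q) := by
  obtain ⟨r, hr⟩ := Module.projective_lifting_property g q hg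
  replace hr (x : F) : g (r x) = q x := LinearMap.congr_fun hr x
  have hgf (y : P) : g (f y) = 0 := hfg.apply_apply_eq_zero y
  refine ⟨r.coprod f, fun m => ?_, ⟨LinearEquiv.ofBijective
    (LinearMap.restrict (LinearMap.fst R F P) fun z hz => ?_) ⟨?_, fun x => ?_⟩⟩⟩
  · obtain ⟨x, hx⟩ := hq (g m)
    obtain ⟨y, hy⟩ := (hfg (m - r x)).1 (by rw [map_sub, hr, hx, sub_self])
    exact ⟨(x, y), by simp [hy]⟩
  · have h₁ : r z.1 + f z.2 = 0 := hz
    have h₂ := congrArg g h₁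
    rwa [map_add, hr, hgf, add_zero, map_zero] at h₂
  · rw [← LinearMap.ker_eq_bot, LinearMap.ker_eq_bot']
    rintro ⟨⟨x, y⟩, hz⟩ h
    have hx : x = 0 := congrArg Subtype.val h
    have h₁ : r x + f y = 0 := hz
    rw [hx, map_zero, zero_add] at h₁
    have hy : y = 0 := hf (by rw [h₁, map_zero])
    simp [hx, hy]
  · obtain ⟨x, hx⟩ := x
    obtain ⟨y, hy⟩ := (hfg (r x)).1 (by rw [hr]; exact hx)
    exact ⟨⟨(x, -y), by simp [hy]⟩, rfl⟩

/-- The dual of Schanuel's lemma: if the inclusions of a common kernel into `P` and `Q` extend along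
each other, the two cokernels are stably isomorphic. -/
lemma schanuel_dual (p : P →ₗ[R] M) (q : Q →ₗ[R] N) (hp : Function.Surjective p)
    (hq : Function.Surjective q) (e : LinearMap.ker p ≃ₗ[R] LinearMap.ker q) (a : P →ₗ[R] Q)
    (b : Q →ₗ[R] P) (ha : ∀ x : LinearMap.ker p, a x = e x)
    (hb : ∀ y : LinearMap.ker q, b y = e.symm y) :
    Nonempty ((M × Q) ≃ₗ[R] (N × P)) := by
  let θ : (P × Q) →ₗ[R] (N × P) :=
    LinearMap.prod (q ∘ₗ (LinearMap.snd R P Q + a ∘ₗ LinearMap.fst R P Q))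
      (LinearMap.fst R P Q - b ∘ₗ (LinearMap.snd R P Q + a ∘ₗ LinearMap.fst R P Q))
  have hθ : Function.Surjective θ := by
    rintro ⟨n, x⟩
    obtain ⟨y, rfl⟩ := hq n
    exact ⟨(x + b y, y - a (x + b y)), by simp [θ]⟩
  have hker : LinearMap.ker (p.prodMap (LinearMap.id : Q →ₗ[R] Q)) = LinearMap.ker θ := by
    ext ⟨x, y⟩
    have h₁ : (x, y) ∈ LinearMap.ker (p.prodMap (LinearMap.id : Q →ₗ[R] Q)) ↔ p x = 0 ∧ y = 0 := by
      simp
    have h₂ : (x, y) ∈ LinearMap.ker θ ↔ q (y + a x) = 0 ∧ x - b (y + a x) = 0 := by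
      simp only [LinearMap.mem_ker, θ]
      exact Prod.mk_eq_zero
    rw [h₁, h₂]
    constructor
    · rintro ⟨hx, rfl⟩
      have := ha ⟨x, hx⟩
      change a x = _ at this
      rw [zero_add, this, hb, LinearEquiv.symm_apply_apply]
      exact ⟨(e ⟨x, hx⟩).2, sub_self x⟩
    · rintro ⟨hy, hx⟩
      rw [sub_eq_zero] at hx
      have h₃ := hb ⟨y + a x, hy⟩
      change b (y + a x) = _ at h₃
      have hx' : x = e.symm ⟨y + a x, hy⟩ := hx.trans h₃
      have h₄ := ha (e.symm ⟨y + a x, hy⟩)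
      rw [← hx', LinearEquiv.apply_symm_apply] at h₄
      refine ⟨by rw [hx']; exact (e.symm ⟨y + a x, hy⟩).2, ?_⟩
      exact left_eq_add.1 (h₄.trans (add_comm _ _))
  exact ⟨((p.prodMap LinearMap.id).quotKerEquivOfSurjective
    (hp.prodMap Function.surjective_id)).symm ≪≫ₗ Submodule.quotEquivOfEq _ _ hker ≪≫ₗ
    θ.quotKerEquivOfSurjective hθ⟩

end StablyIso

/-! ### The monoid of stable isomorphism classes and its syzygy operator -/

section StableClass

variable (R : Type u) [CommRing R]

/-- Stable isomorphism of finitely generated modules. -/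
def stableSetoid : Setoid (FGMod R) where
  r X Y := StablyIso R X.carrier Y.carrier
  iseqv := ⟨fun X => .of_equiv (.refl R X.carrier), .symm, .trans⟩

/-- The set of stable isomorphism classes of finitely generated modules. -/
def StableClass : Type (u + 1) := Quotient (stableSetoid R)

/-- The stable isomorphism class of a finitely generated module. -/
def stableClass (M : Type u) [AddCommGroup M] [Module R M] [Module.Finite R M] : StableClass R :=
  Quotient.mk (stableSetoid R) (FGMod.mk M)

variable {R}

lemma stableClass_eq_iff {M N : Type u} [AddCommGroup M] [Module R M] [Module.Finite R M]
    [AddCommGroup N] [Module R N] [Module.Finite R N] :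
    stableClass R M = stableClass R N ↔ StablyIso R M N :=
  Quotient.eq (r := stableSetoid R)

@[elab_as_elim]
lemma StableClass.ind {motive : StableClass R → Prop}
    (h : ∀ (M : Type u) [AddCommGroup M] [Module R M] [Module.Finite R M],
      motive (stableClass R M)) (x : StableClass R) : motive x :=
  Quotient.ind (fun X => h X.carrier) x

/-- Addition of stable classes is induced by the direct sum. -/
instance : Add (StableClass R) where
  add := Quotient.map₂ (fun X Y => FGMod.mk (X.carrier × Y.carrier))
    fun _ _ h _ _ h' => StablyIso.prod h h'

instance : Zero (StableClass R) where
  zero := stableClass R PUnit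

lemma stableClass_add (M N : Type u) [AddCommGroup M] [Module R M] [Module.Finite R M]
    [AddCommGroup N] [Module R N] [Module.Finite R N] :
    stableClass R M + stableClass R N = stableClass R (M × N) := rfl

lemma stableClass_zero : (0 : StableClass R) = stableClass R PUnit := rfl

instance : AddCommMonoid (StableClass R) where
  add_assoc x y z := by
    induction x using StableClass.ind with | _ M
    induction y using StableClass.ind with | _ N
    induction z using StableClass.ind with | _ K
    simp only [stableClass_add, stableClass_eq_iff]
    exact .of_equiv (LinearEquiv.prodAssoc R M N K)
  zero_add x := by
    induction x using StableClass.ind with | _ M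
    rw [stableClass_zero, stableClass_add, stableClass_eq_iff]
    exact .of_equiv LinearEquiv.uniqueProd
  add_zero x := by
    induction x using StableClass.ind with | _ M
    rw [stableClass_zero, stableClass_add, stableClass_eq_iff]
    exact .of_equiv LinearEquiv.prodUnique
  add_comm x y := by
    induction x using StableClass.ind with | _ M
    induction y using StableClass.ind with | _ N
    rw [stableClass_add, stableClass_add, stableClass_eq_iff]
    exact .of_equiv (LinearEquiv.prodComm R M N)
  nsmul := nsmulRec

instance [IsNoetherianRing R] [IsLocalRing R] : IsCancelAdd (StableClass R) :=
  have : IsRightCancelAdd (StableClass R) := ⟨fun x y z h => by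
    induction x using StableClass.ind with | _ K
    induction y using StableClass.ind with | _ M
    induction z using StableClass.ind with | _ N
    simp only [stableClass_add, stableClass_eq_iff] at h ⊢
    exact h.cancel⟩
  AddCommMagma.IsRightCancelAdd.toIsCancelAdd _

variable [IsNoetherianRing R]

/-- The class of the kernel of a surjection from a free module of finite rank. By Schanuel's lemma
it depends neither on the surjection nor on the representative of the stable class. -/
noncomputable def syz : StableClass R → StableClass R :=
  Quotient.map
    (fun X => FGMod.mk (LinearMap.ker (Module.Finite.exists_fin' R X.carrier).choose_spec.choose))
    fun X Y h => StablyIso.ker h _ _ (Module.Finite.exists_fin' R X.carrier).choose_spec.choose_spec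
      (Module.Finite.exists_fin' R Y.carrier).choose_spec.choose_spec

lemma syz_stableClass {M F : Type u} [AddCommGroup M] [Module R M] [Module.Finite R M]
    [AddCommGroup F] [Module R F] [Module.Finite R F] [Module.Free R F] (p : F →ₗ[R] M)
    (hp : Function.Surjective p) : syz (stableClass R M) = stableClass R (LinearMap.ker p) :=
  stableClass_eq_iff.2 <| StablyIso.ker (.of_equiv (.refl R M)) _ _
    (Module.Finite.exists_fin' R M).choose_spec.choose_spec hp

lemma syz_add (x y : StableClass R) : syz (x + y) = syz x + syz y := by
  induction x using StableClass.ind with | _ M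
  induction y using StableClass.ind with | _ N
  obtain ⟨m, p, hp⟩ := Module.Finite.exists_fin' R M
  obtain ⟨n, q, hq⟩ := Module.Finite.exists_fin' R N
  rw [syz_stableClass p hp, syz_stableClass q hq, stableClass_add, stableClass_add,
    syz_stableClass (p.prodMap q) (hp.prodMap hq), stableClass_eq_iff]
  exact .of_equiv (kerProdMapEquiv p q)

lemma syz_iterate_add (k : ℕ) (x y : StableClass R) :
    syz^[k] (x + y) = syz^[k] x + syz^[k] y := by
  induction k generalizing x y with
  | zero => rfl
  | succ k ih => rw [Function.iterate_succ_apply, syz_add, ih]; rfl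

lemma syz_eq_of_exact {P M M' : Type u} [AddCommGroup P] [AddCommGroup M] [AddCommGroup M']
    [Module R P] [Module R M] [Module R M'] [Module.Finite R P] [Module.Finite R M]
    [Module.Finite R M'] [Module.Free R P] (f : P →ₗ[R] M) (g : M →ₗ[R] M')
    (hf : Function.Injective f) (hfg : Function.Exact f g) (hg : Function.Surjective g) :
    syz (stableClass R M) = syz (stableClass R M') := by
  obtain ⟨n, q, hq⟩ := Module.Finite.exists_fin' R M'
  obtain ⟨s, hs, ⟨e⟩⟩ := exists_coprod_ker_equiv f g hf hfg hg q hq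
  rw [syz_stableClass s hs, syz_stableClass q hq, stableClass_eq_iff]
  exact .of_equiv e

end StableClass

/-! ### An invariant of `J(R)` -/

section Invariant

/-- Two-sided sequences in `G`. This is a type of its own so that it can carry the
`ℤ[t, t⁻¹]`-module structure in which `t` acts by the shift `a ↦ (k ↦ a (k - 1))`. -/
def Sequences (G : Type*) : Type _ := ℤ → G

namespace Sequences

variable (G : Type*) [AddCommGroup G]

instance : AddCommGroup (Sequences G) := inferInstanceAs (AddCommGroup (ℤ → G))

variable {G} in
lemma add_apply (a b : Sequences G) (k : ℤ) : (a + b) k = a k + b k := rfl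

variable {G} in
lemma sub_apply (a b : Sequences G) (k : ℤ) : (a - b) k = a k - b k := rfl

/-- The action of the powers of `t` on sequences. -/
def shift : Multiplicative ℤ →* AddMonoid.End (Sequences G) where
  toFun i :=
    { toFun := fun a k => a (k - i.toAdd)
      map_zero' := rfl
      map_add' := fun _ _ => rfl }
  map_one' := by
    ext a
    funext k
    exact congrArg a (sub_zero k)
  map_mul' i j := by
    ext a
    funext k
    exact congrArg a (by rw [toAdd_mul]; ring)

noncomputable instance : Module ℤ[T;T⁻¹] (Sequences G) :=
  Module.compHom (Sequences G)
    (AddMonoidAlgebra.lift ℤ (AddMonoid.End (Sequences G)) ℤ (shift G)).toRingHom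

variable {G}

lemma C_mul_T_smul (c i : ℤ) (a : Sequences G) (k : ℤ) :
    ((LaurentPolynomial.C c * LaurentPolynomial.T i : ℤ[T;T⁻¹]) • a) k = c • a (k - i) := by
  rw [← LaurentPolynomial.single_eq_C_mul_T]
  change (AddMonoidAlgebra.lift ℤ (AddMonoid.End (Sequences G)) ℤ (shift G)
    (AddMonoidAlgebra.single i c)) a k = _
  rw [AddMonoidAlgebra.lift_single]
  rfl

lemma T_smul (i : ℤ) (a : Sequences G) (k : ℤ) :
    ((LaurentPolynomial.T i : ℤ[T;T⁻¹]) • a) k = a (k - i) := by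
  simpa using C_mul_T_smul 1 i a k

variable (G) in
/-- The sequences which vanish for all large indices. -/
noncomputable def eventuallyZero : Submodule ℤ[T;T⁻¹] (Sequences G) where
  carrier := {a | ∃ n : ℤ, ∀ k, n ≤ k → a k = 0}
  zero_mem' := ⟨0, fun _ _ => rfl⟩
  add_mem' := by
    rintro a b ⟨m, hm⟩ ⟨n, hn⟩
    refine ⟨max m n, fun k hk => ?_⟩
    rw [add_apply, hm k (le_of_max_le_left hk), hn k (le_of_max_le_right hk), add_zero]
  smul_mem' p a ha := by
    induction p using LaurentPolynomial.induction_on' with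
    | add p q hp hq =>
      obtain ⟨m, hm⟩ := hp
      obtain ⟨n, hn⟩ := hq
      refine ⟨max m n, fun k hk => ?_⟩
      rw [add_smul, add_apply, hm k (le_of_max_le_left hk), hn k (le_of_max_le_right hk), add_zero]
    | C_mul_T i c =>
      obtain ⟨n, hn⟩ := ha
      exact ⟨n + i, fun k hk => by rw [C_mul_T_smul, hn _ (by omega), smul_zero]⟩

end Sequences

variable {R : Type u} [CommRing R] [IsNoetherianRing R]

/-- The sequence `k ↦ Ωᵏ M` of syzygies of a stable class in the Grothendieck group, extended by
zero to negative `k`. -/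
noncomputable def syzSequence (x : StableClass R) :
    Sequences (Algebra.GrothendieckAddGroup (StableClass R)) :=
  fun k => if 0 ≤ k then Algebra.GrothendieckAddGroup.of (syz^[k.toNat] x) else 0

lemma syzSequence_natCast (x : StableClass R) (k : ℕ) :
    syzSequence x k = Algebra.GrothendieckAddGroup.of (syz^[k] x) := by
  simp [syzSequence]

lemma syzSequence_succ (x : StableClass R) (k : ℕ) :
    syzSequence x (k + 1 : ℕ) = syzSequence (syz x) k := by
  rw [syzSequence_natCast, syzSequence_natCast, Function.iterate_succ_apply]

variable (R) in
/-- The `ℤ[t, t⁻¹]`-linear map sending `[M]` to its sequence of syzygies. -/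
noncomputable def syzSequenceHom : FreeOnClasses R →ₗ[ℤ[T;T⁻¹]]
    Sequences (Algebra.GrothendieckAddGroup (StableClass R)) :=
  Finsupp.linearCombination ℤ[T;T⁻¹] fun c => syzSequence <|
    Quotient.map' (s₁ := FGMod.isoSetoid R) (s₂ := stableSetoid R) id
      (fun _ _ ⟨e⟩ => StablyIso.of_equiv e) c

lemma syzSequenceHom_basisElt (M : Type u) [AddCommGroup M] [Module R M] [Module.Finite R M] :
    syzSequenceHom R (basisElt R M) = syzSequence (stableClass R M) := by
  rw [syzSequenceHom, basisElt, Finsupp.linearCombination_single, one_smul]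
  rfl

/-- Modulo eventually zero sequences, the sequence of syzygies is an invariant of the class in
`J(R)`. -/
lemma relations_le_comap_eventuallyZero [IsLocalRing R] :
    relations R ≤ (Sequences.eventuallyZero _).comap (syzSequenceHom R) := by
  rw [relations, Submodule.span_le]
  -- Index `0` is left out: `M` and its quotient by a projective submodule need not be stably
  -- isomorphic, only their syzygies are, and `t • a` takes at `0` the value of `a` at `-1`.
  have key (a : Sequences (Algebra.GrothendieckAddGroup (StableClass R)))
      (h : ∀ k : ℕ, a (k + 1 : ℕ) = 0) : a ∈ Sequences.eventuallyZero _ := by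
    refine ⟨1, fun k hk => ?_⟩
    obtain ⟨k, rfl⟩ : ∃ j : ℕ, k = (j + 1 : ℕ) := ⟨(k - 1).toNat, by omega⟩
    exact h k
  rintro _ (⟨P, M, M', f, g, hf, hfg, hg⟩ | ⟨M', P, M, f, g, hf, hfg, hg⟩ | ⟨M, M'⟩)
  · have : Module.Free R P := Module.free_of_flat_of_isLocalRing
    refine key _ fun k => ?_
    rw [map_sub, syzSequenceHom_basisElt, syzSequenceHom_basisElt]
    rw [Sequences.sub_apply, syzSequence_succ, syzSequence_succ,
      syz_eq_of_exact f g hf hfg hg, sub_self]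
  · have : Module.Free R P := Module.free_of_flat_of_isLocalRing
    refine key _ fun k => ?_
    rw [map_sub, map_smul, syzSequenceHom_basisElt, syzSequenceHom_basisElt]
    have hker : stableClass R (LinearMap.ker g) = stableClass R M' := stableClass_eq_iff.2 <|
      .of_equiv ((LinearEquiv.ofEq _ _ (LinearMap.exact_iff.1 hfg)).trans
        (LinearEquiv.ofInjective f hf).symm)
    rw [Sequences.sub_apply, Sequences.T_smul, syzSequence_succ, syz_stableClass g hg, hker,
      show ((k + 1 : ℕ) : ℤ) - 1 = k by push_cast; ring, sub_self]
  · refine key _ fun k => ?_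
    rw [map_sub, map_sub, syzSequenceHom_basisElt, syzSequenceHom_basisElt,
      syzSequenceHom_basisElt, ← stableClass_add]
    rw [Sequences.sub_apply, Sequences.sub_apply, syzSequence_natCast,
      syzSequence_natCast, syzSequence_natCast, syz_iterate_add, map_add]
    abel

/-- Equality in `J(R)` forces high syzygies to be stably isomorphic. -/
theorem exists_syz_iterate_eq [IsLocalRing R] {M N : Type u} [AddCommGroup M] [Module R M]
    [Module.Finite R M] [AddCommGroup N] [Module R N] [Module.Finite R N]
    (h : jClass R M = jClass R N) :
    ∃ k : ℕ, syz^[k] (stableClass R M) = syz^[k] (stableClass R N) := by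
  have h₁ : basisElt R M - basisElt R N ∈ relations R := (Submodule.Quotient.eq _).1 h
  obtain ⟨n, hn⟩ := relations_le_comap_eventuallyZero h₁
  refine ⟨n.toNat, ?_⟩
  have h₂ := hn n.toNat (Int.self_le_toNat n)
  rw [map_sub, syzSequenceHom_basisElt, syzSequenceHom_basisElt, Sequences.sub_apply,
    sub_eq_zero, syzSequence_natCast, syzSequence_natCast] at h₂
  -- The monoid of stable classes is cancellative, so it embeds into its Grothendieck group.
  exact (AddLocalization.addMonoidOf ⊤).top_injective_iff.2 inferInstance h₂

end Invariant

/-! ### Recovering a module from its syzygies -/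

section Descent

open CategoryTheory Abelian

variable {R : Type u} [CommRing R]

/-- If `Ext¹(M, R) = 0`, every map from a syzygy of `M` to a free module extends. -/
lemma exists_extension_of_subsingleton_ext {M F G : Type u} [AddCommGroup M] [AddCommGroup F]
    [AddCommGroup G] [Module R M] [Module R F] [Module R G] [Module.Finite R G] [Module.Free R G]
    (h : Subsingleton (Ext (ModuleCat.of R M) (ModuleCat.of R R) 1)) (p : F →ₗ[R] M)
    (hp : Function.Surjective p) (φ : LinearMap.ker p →ₗ[R] G) :
    ∃ a : F →ₗ[R] G, ∀ x : LinearMap.ker p, a x = φ x := by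
  have key (ψ : LinearMap.ker p →ₗ[R] R) : ∃ a : F →ₗ[R] R, ∀ x : LinearMap.ker p, a x = ψ x := by
    have hS := LinearMap.shortExact_shortComplexKer hp
    let ψ' : p.shortComplexKer.X₁ ⟶ ModuleCat.of R R := ModuleCat.ofHom ψ
    obtain ⟨y, hy⟩ := Ext.contravariant_sequence_exact₁ hS (ModuleCat.of R R) (Ext.mk₀ ψ')
      (add_zero 1) (h.elim _ _)
    obtain ⟨a, rfl⟩ := (Ext.mk₀_bijective _ _).2 y
    rw [Ext.mk₀_comp_mk₀, (Ext.mk₀_bijective _ _).1.eq_iff] at hy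
    exact ⟨a.hom, fun x => congrArg (fun b => ModuleCat.Hom.hom b x) hy⟩
  obtain ⟨n, ⟨e⟩⟩ := nonempty_equiv_fin_fun R G
  choose a ha using fun i => key (LinearMap.proj i ∘ₗ e.toLinearMap ∘ₗ φ)
  refine ⟨e.symm.toLinearMap ∘ₗ LinearMap.pi a, fun x => ?_⟩
  rw [LinearMap.comp_apply, LinearEquiv.coe_coe, LinearEquiv.symm_apply_eq]
  funext i
  exact ha i x

lemma subsingleton_ext_ker {M F : Type u} [AddCommGroup M] [AddCommGroup F] [Module R M]
    [Module R F] [Module.Free R F] (p : F →ₗ[R] M) (hp : Function.Surjective p) {i : ℕ}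
    (hi : 0 < i) (h : Subsingleton (Ext (ModuleCat.of R M) (ModuleCat.of R R) (i + 1))) :
    Subsingleton (Ext (ModuleCat.of R (LinearMap.ker p)) (ModuleCat.of R R) i) := by
  have hS := LinearMap.shortExact_shortComplexKer hp
  have : Projective p.shortComplexKer.X₂ :=
    ModuleCat.projective_of_free (Module.Free.chooseBasis R F)
  obtain ⟨i, rfl⟩ := Nat.exists_eq_add_of_lt hi
  refine subsingleton_of_forall_eq 0 fun y => ?_
  obtain ⟨z, rfl⟩ := Ext.contravariant_sequence_exact₁ hS (ModuleCat.of R R) y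
    (add_comm 1 _) (h.elim _ _)
  rw [Ext.eq_zero_of_projective z, Ext.comp_zero]

/-- Modules with `Ext¹(-, R) = 0` and stably isomorphic syzygies are stably isomorphic. -/
lemma StablyIso.of_ker {M N F G : Type u} [AddCommGroup M] [AddCommGroup N] [AddCommGroup F]
    [AddCommGroup G] [Module R M] [Module R N] [Module R F] [Module R G] [Module.Finite R F]
    [Module.Free R F] [Module.Finite R G] [Module.Free R G] (p : F →ₗ[R] M) (q : G →ₗ[R] N)
    (hp : Function.Surjective p) (hq : Function.Surjective q)
    (hM : Subsingleton (Ext (ModuleCat.of R M) (ModuleCat.of R R) 1))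
    (hN : Subsingleton (Ext (ModuleCat.of R N) (ModuleCat.of R R) 1))
    (h : StablyIso R (LinearMap.ker p) (LinearMap.ker q)) : StablyIso R M N := by
  obtain ⟨m, n, ⟨e⟩⟩ := h
  let p' : (F × (Fin m → R)) →ₗ[R] M := p ∘ₗ LinearMap.fst R F _
  let q' : (G × (Fin n → R)) →ₗ[R] N := q ∘ₗ LinearMap.fst R G _
  have hp' : Function.Surjective p' := hp.comp LinearMap.fst_surjective
  have hq' : Function.Surjective q' := hq.comp LinearMap.fst_surjective
  let e' : LinearMap.ker p' ≃ₗ[R] LinearMap.ker q' :=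
    kerCompFstEquiv p _ ≪≫ₗ e ≪≫ₗ (kerCompFstEquiv q _).symm
  obtain ⟨a, ha⟩ := exists_extension_of_subsingleton_ext hM p' hp'
    ((LinearMap.ker q').subtype ∘ₗ e'.toLinearMap)
  obtain ⟨b, hb⟩ := exists_extension_of_subsingleton_ext hN q' hq'
    ((LinearMap.ker p').subtype ∘ₗ e'.symm.toLinearMap)
  obtain ⟨f⟩ := schanuel_dual p' q' hp' hq' e' a b ha hb
  exact .of_free f

theorem StablyIso.of_syz_iterate_eq [IsNoetherianRing R] (k : ℕ) {M N : Type u} [AddCommGroup M]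
    [AddCommGroup N] [Module R M] [Module R N] [Module.Finite R M] [Module.Finite R N]
    (hM : ∀ i, 0 < i → Subsingleton (Ext (ModuleCat.of R M) (ModuleCat.of R R) i))
    (hN : ∀ i, 0 < i → Subsingleton (Ext (ModuleCat.of R N) (ModuleCat.of R R) i))
    (h : syz^[k] (stableClass R M) = syz^[k] (stableClass R N)) : StablyIso R M N := by
  induction k generalizing M N with
  | zero => exact stableClass_eq_iff.1 h
  | succ k ih =>
    obtain ⟨m, p, hp⟩ := Module.Finite.exists_fin' R M
    obtain ⟨n, q, hq⟩ := Module.Finite.exists_fin' R N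
    rw [Function.iterate_succ_apply, Function.iterate_succ_apply, syz_stableClass p hp,
      syz_stableClass q hq] at h
    exact .of_ker p q hp hq (hM 1 one_pos) (hN 1 one_pos) <|
      ih (fun i hi => subsingleton_ext_ker p hp hi (hM _ i.succ_pos))
        (fun i hi => subsingleton_ext_ker q hq hi (hN _ i.succ_pos)) h

end Descent

/-! ### Classes in `J(R)` and free summands -/

section Classes

variable {R : Type u} [CommRing R]

lemma jClass_congr {M N : Type u} [AddCommGroup M] [AddCommGroup N] [Module R M] [Module R N]
    [Module.Finite R M] [Module.Finite R N] (e : M ≃ₗ[R] N) : jClass R M = jClass R N := by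
  have : isoClass R M = isoClass R N := Quotient.sound ⟨e⟩
  rw [jClass, jClass, basisElt, basisElt, this]

lemma jClass_prod_free (M F : Type u) [AddCommGroup M] [AddCommGroup F] [Module R M] [Module R F]
    [Module.Finite R M] [Module.Finite R F] [Module.Free R F] :
    jClass R (M × F) = jClass R M :=
  (Submodule.Quotient.eq _).2 <| Submodule.subset_span <|
    .quot F (M × F) M (LinearMap.inr R M F) (LinearMap.fst R M F) LinearMap.inr_injective
      .inr_fst LinearMap.fst_surjective

lemma StablyIso.jClass_eq {M N : Type u} [AddCommGroup M] [AddCommGroup N] [Module R M]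
    [Module R N] [Module.Finite R M] [Module.Finite R N] :
    StablyIso R M N → jClass R M = jClass R N
  | ⟨m, n, ⟨e⟩⟩ => by
    rw [← jClass_prod_free M (Fin m → R), jClass_congr e, jClass_prod_free]

lemma hasFreeSummand_of_equiv {M N F : Type u} [AddCommGroup M] [AddCommGroup N] [AddCommGroup F]
    [Module R M] [Module R N] [Module R F] [Module.Free R F] [Nontrivial F]
    (e : M ≃ₗ[R] (N × F)) : HasFreeSummand R M := by
  let i : F →ₗ[R] M := e.symm.toLinearMap ∘ₗ LinearMap.inr R N F
  have hi : Function.Injective i := e.symm.injective.comp LinearMap.inr_injective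
  let f := LinearEquiv.ofInjective i hi
  refine ⟨LinearMap.range i, LinearMap.range (e.symm.toLinearMap ∘ₗ LinearMap.inl R N F), ?_,
    .of_equiv f, f.symm.toEquiv.nontrivial⟩
  rw [LinearMap.range_comp, LinearMap.range_comp]
  exact (LinearMap.isCompl_range_inl_inr (R := R) (M := N) (M₂ := F)).symm.map
    (Submodule.orderIsoMapComap e.symm)

/-- Splitting off the common part of the free modules, what remains is a free summand of `M` or of
`N` unless both ranks agree. -/
lemma StablyIso.nonempty_equiv [IsNoetherianRing R] [IsLocalRing R] {M N : Type u}
    [AddCommGroup M] [AddCommGroup N] [Module R M] [Module R N] (hM : ¬ HasFreeSummand R M)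
    (hN : ¬ HasFreeSummand R N) (h : StablyIso R M N) : Nonempty (M ≃ₗ[R] N) := by
  have aux {M N : Type u} [AddCommGroup M] [AddCommGroup N] [Module R M] [Module R N]
      (hM : ¬ HasFreeSummand R M) (m k : ℕ)
      (e : (M × (Fin m → R)) ≃ₗ[R] (N × (Fin (k + m) → R))) : Nonempty (M ≃ₗ[R] N) := by
    let s : (Fin (k + m) → R) ≃ₗ[R] (Fin k → R) × (Fin m → R) :=
      LinearEquiv.funCongrLeft R R finSumFinEquiv ≪≫ₗ
        LinearEquiv.sumArrowLequivProdArrow (Fin k) (Fin m) R R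
    obtain ⟨f⟩ := cancel_of_finite (L := Fin m → R) <|
      e ≪≫ₗ LinearEquiv.prodCongr (.refl R N) s ≪≫ₗ (LinearEquiv.prodAssoc R N _ _).symm
    obtain _ | k := k
    · exact ⟨f ≪≫ₗ LinearEquiv.prodUnique⟩
    · exact absurd (hasFreeSummand_of_equiv f) hM
  obtain ⟨m, n, ⟨e⟩⟩ := h
  obtain hmn | hnm := le_total m n
  · obtain ⟨k, rfl⟩ := Nat.exists_eq_add_of_le' hmn
    exact aux hM m k e
  · obtain ⟨k, rfl⟩ := Nat.exists_eq_add_of_le' hnm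
    exact (aux hN n k e.symm).map LinearEquiv.symm

end Classes

end GorensteinJ

theorem corollary4p2 (R : Type u) [CommRing R] [GorensteinJ.IsGorensteinLocalRing R]
    (M N : Type u) [AddCommGroup M] [AddCommGroup N] [Module R M] [Module R N]
    [Module.Finite R M] [Module.Finite R N]
    (hM : GorensteinJ.IsMCM R M) (hN : GorensteinJ.IsMCM R N) :
    (GorensteinJ.jClass R M = GorensteinJ.jClass R N ↔
      ∃ m n : ℕ, Nonempty ((M × (Fin m → R)) ≃ₗ[R] (N × (Fin n → R)))) ∧
    (¬ GorensteinJ.HasFreeSummand R M → ¬ GorensteinJ.HasFreeSummand R N →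
      (GorensteinJ.jClass R M = GorensteinJ.jClass R N ↔ Nonempty (M ≃ₗ[R] N))) := by
  have key : GorensteinJ.jClass R M = GorensteinJ.jClass R N ↔ GorensteinJ.StablyIso R M N := by
    refine ⟨fun h => ?_, GorensteinJ.StablyIso.jClass_eq⟩
    obtain ⟨k, hk⟩ := GorensteinJ.exists_syz_iterate_eq h
    exact .of_syz_iterate_eq k (fun i hi => hM.subsingleton_ext M i hi)
      (fun i hi => hN.subsingleton_ext N i hi) hk
  exact ⟨key, fun hM' hN' => ⟨fun h => (key.1 h).nonempty_equiv hM' hN',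
    fun ⟨e⟩ => GorensteinJ.jClass_congr e⟩⟩
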